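/- **Setting.** There are $n$ buyers and $m$ divisible goods, each in unit supply. Buyer $i\in[n]$ has a budget $B_i\ge 0$ and, for each good $j\in[m]$, a valuation $v_{ij}:[0,\infty)\to\mathbb R$ that is non-decreasing and concave with $v_{ij}(0)=0$. Consider the primal program $$\max_{u,\delta,x}\ \sum_{i=1}^n\bigl(B_i\ln u_i-\delta_i\bigr)\quad\text{s.t.}\quad u_i\le\sum_{j=1}^m v_{ij}(x_{ij})+\delta_i\ \ \forall i,\qquad \sum_{i=1}^n x_{ij}\le 1\ \ \forall j,\qquad u_i,\delta_i,x_{ij}\ge 0,$$ and its Fenchel dual $$\min_{\alpha,p}\ \sum_{i=1}^n\Bigl(B_i\ln\frac{B_i}{\alpha_i}-B_i\Bigr)+\sum_{j=1}^m p_j+\sum_{i=1}^n\sum_{j=1}^m\ \sup_{t\ge 0}\bigl(\alpha_i v_{ij}(t)-p_j t\bigr)\quad\text{s.t.}\quad 0<\alpha_i\le 1\ \ \forall i,\qquad p_j\ge 0\ \ \forall j,$$ with the usual conventions $0\ln 0=0$, $0\ln\frac{0}{\alpha_i}=0$ and $B_i\ln 0=-\infty$ for $B_i>0$. (Optimal solutions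 have a finite objective value.) **Theorem.** Let $(u,\delta,x)$ be an optimal solution of the primal program and $(\alpha,p)$ an optimal solution of the dual program. Then: 1. (Individual rationality) $p_j x_{ij}\le v_{ij}(x_{ij})$ for all $i\in[n]$, $j\in[m]$. 2. (Budget feasibility) $\sum_{j=1}^m p_j x_{ij}\le B_i$ for all $i\in[n]$. 3. For every good $j$, if $p_j>0$ then $\sum_{i=1}^n x_{ij}=1$. 4. Suppose that for all $i,j$ the derivatives $v_{ij}'(0)$ (from the right) and $v_{ij}'(1)$ exist and are finite, and that $v_{ij}'(1)>0$ unless $v_{ij}\equiv 0$. Let $r:=\max_{i,j}\frac{v_{ij}'(0)}{v_{ij}'(1)}$, where the ratio is taken to be $1$ if $v_{ij}\equiv 0$. Then, with $\rho:=r$, each buyer $i\in[n]$ satisfies at least one of the following: - (a) (utility maximization) $x_i=(x_{i1},\dots,x_{im})$ maximizes $\sum_{j=1}^m\bigl(v_{ij}(y_j)-p_j y_j\bigr)$ over all $y\in\mathbb R_{\ge0}^m$ with $\sum_{j=1}^m p_j y_j\le B_i$; - (b) $\sum_{j=1}^m p_j x_{ij}\ge B_i/\rho$. If moreover every $v_{ij}$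 is differentiable on $[0,1]$ and $t\mapsto t\,v_{ij}'(t)$ is non-decreasing on $[0,1]$ for all $i,j$, then the same holds with $\rho:=1+\ln r$. -/

import Mathlib

open scoped BigOperators

noncomputable section

namespace EisenbergGale

/-- A valuation `v : [0, ∞) → ℝ` of one buyer for one good (the values of `v` at negative
arguments are irrelevant): non-decreasing, concave, and zero at zero. -/
structure IsConcaveValuation (v : ℝ → ℝ) : Prop where
  monotone : MonotoneOn v (Set.Ici 0)
  concave : ConcaveOn ℝ (Set.Ici 0) v
  zero : v 0 = 0

/-- Constraints of the primal program in the variables `u, δ, x`. The field `u_pos` is the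
implicit constraint that the objective is finite: `B ln 0 = -∞` for `B > 0`
(whereas `0 ln 0 = 0`). -/
structure PrimalFeasible {n m : ℕ} (B : Fin n → ℝ) (v : Fin n → Fin m → ℝ → ℝ)
    (u δ : Fin n → ℝ) (x : Fin n → Fin m → ℝ) : Prop where
  utility : ∀ i, u i ≤ ∑ j, v i j (x i j) + δ i
  supply : ∀ j, ∑ i, x i j ≤ 1
  u_nonneg : ∀ i, 0 ≤ u i
  u_pos : ∀ i, 0 < B i → 0 < u i
  delta_nonneg : ∀ i, 0 ≤ δ i
  x_nonneg : ∀ i j, 0 ≤ x i j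

/-- The primal objective `∑ i, (B i * ln (u i) - δ i)`. -/
def primalObjective {n : ℕ} (B u δ : Fin n → ℝ) : ℝ :=
  ∑ i, (B i * Real.log (u i) - δ i)

/-- `(u, δ, x)` is an optimal solution of the primal (maximization) program. -/
def IsPrimalOptimal {n m : ℕ} (B : Fin n → ℝ) (v : Fin n → Fin m → ℝ → ℝ)
    (u δ : Fin n → ℝ) (x : Fin n → Fin m → ℝ) : Prop :=
  PrimalFeasible B v u δ x ∧
    ∀ (u' δ' : Fin n → ℝ) (x' : Fin n → Fin m → ℝ), PrimalFeasible B v u' δ' x' →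
      primalObjective B u' δ' ≤ primalObjective B u δ

/-- Constraints of the dual program in the variables `α, p`. The field `bounded` is the implicit
constraint that the objective is finite: none of the suprema in it is `+∞`. -/
structure DualFeasible {n m : ℕ} (v : Fin n → Fin m → ℝ → ℝ)
    (α : Fin n → ℝ) (p : Fin m → ℝ) : Prop where
  alpha_pos : ∀ i, 0 < α i
  alpha_le_one : ∀ i, α i ≤ 1
  price_nonneg : ∀ j, 0 ≤ p j
  bounded : ∀ i j, BddAbove (Set.range fun t : Set.Ici (0 : ℝ) => α i * v i j t - p j * t)

/-- The dual objective
`∑ i, (B i * ln (B i / α i) - B i) + ∑ j, p j + ∑ i, ∑ j, sup_{t ≥ 0} (α i * v i j t - p j * t)`. -/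
def dualObjective {n m : ℕ} (B : Fin n → ℝ) (v : Fin n → Fin m → ℝ → ℝ)
    (α : Fin n → ℝ) (p : Fin m → ℝ) : ℝ :=
  ∑ i, (B i * Real.log (B i / α i) - B i) + ∑ j, p j
    + ∑ i, ∑ j, ⨆ t : Set.Ici (0 : ℝ), (α i * v i j t - p j * t)

/-- `(α, p)` is an optimal solution of the dual (minimization) program. -/
def IsDualOptimal {n m : ℕ} (B : Fin n → ℝ) (v : Fin n → Fin m → ℝ → ℝ)
    (α : Fin n → ℝ) (p : Fin m → ℝ) : Prop :=
  DualFeasible v α p ∧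
    ∀ (α' : Fin n → ℝ) (p' : Fin m → ℝ), DualFeasible v α' p' →
      dualObjective B v α p ≤ dualObjective B v α' p'

/-- The bundles that a buyer with budget `b` can afford at unit prices `p`. -/
def budgetSet {m : ℕ} (p : Fin m → ℝ) (b : ℝ) : Set (Fin m → ℝ) :=
  {y | (∀ j, 0 ≤ y j) ∧ ∑ j, p j * y j ≤ b}

/-- The bundle `y` maximizes the quasi-linear utility over all affordable bundles. -/
def IsUtilityMaximizing {m : ℕ} (w : Fin m → ℝ → ℝ) (p : Fin m → ℝ) (b : ℝ)
    (y : Fin m → ℝ) : Prop :=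
  y ∈ budgetSet p b ∧ IsMaxOn (fun z => ∑ j, (w j (z j) - p j * z j)) (budgetSet p b) y

/-- The marginal value `v'(t)` of a valuation on `[0, ∞)`: the derivative at `t > 0` and the right
derivative at `t = 0`. -/
def marginal (v : ℝ → ℝ) (t : ℝ) : ℝ := derivWithin v (Set.Ici 0) t

/-- The ratio `v'(0) / v'(1)` is a well-defined real number: both derivatives exist, and `v'(1)` is
positive unless `v'(0) = 0` (for a concave valuation, unless `v` is identically zero). -/
structure HasSlopeRatio (v : ℝ → ℝ) : Prop where
  diff_zero : DifferentiableWithinAt ℝ v (Set.Ici 0) 0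
  diff_one : DifferentiableAt ℝ v 1
  pos : marginal v 0 ≠ 0 → 0 < marginal v 1

open Classical in
/-- The ratio `v'(0) / v'(1)`. For the zero valuation, which is linear, it is `1`, as for every
other linear valuation. -/
def slopeRatio (v : ℝ → ℝ) : ℝ :=
  if marginal v 0 = 0 then 1 else marginal v 0 / marginal v 1

/-- The maximum of the ratios `v i j'(0) / v i j'(1)` over all buyers and goods. -/
def maxSlopeRatio {n m : ℕ} (v : Fin n → Fin m → ℝ → ℝ) : ℝ :=
  ⨆ ij : Fin n × Fin m, slopeRatio (v ij.1 ij.2)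

end EisenbergGale

end

namespace EisenbergGale

open Set

/-! ### Lagrangian duality under Slater's condition -/

/-! The primal is a concave program with a Slater point, so Lagrange multipliers exist
(`exists_lagrange_multipliers`). Maximizing the Lagrangian over the primal variables turns the
multipliers into a dual solution of no larger value, up to an arbitrarily small perturbation
(`dual_le_primal`). The duality gap is a sum of nonnegative terms, so each of them vanishes
(`complementarySlackness`): `α i * u i = B i`, the utility constraint is tight, `δ i = 0` or `α i =
1`, unsold goods are free, and `x i j` maximizes `α i * v i j t - p j * t`.

Comparing with `t = 0` gives spending ≤ `α i` times value, hence individual rationality and, after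
summation, budget feasibility. If `α i = 1`, each good is bought in its utility-maximizing amount.
If `δ i = 0`, scaled values add up to `B i`, so it suffices that the scaled value of each good is at
most `ρ` times the spending on it; this is `value_le_slopeRatio_mul` and
`value_le_log_slopeRatio_mul`. -/

lemma nonneg_of_forall_sub_mul_le {a b c : ℝ} (h : ∀ t : ℝ, 0 ≤ t → a - t * b ≤ c) : 0 ≤ b := by
  by_contra! hb
  have h0 := h 0 le_rfl
  have h1 := h ((c - a + 1) / (-b)) (div_nonneg (by linarith) (by linarith))
  have h2 : (c - a + 1) / (-b) * b = -(c - a + 1) := by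
    rw [div_neg, neg_mul, div_mul_cancel₀ _ hb.ne]
  linarith

lemma le_of_forall_pos_sub_mul_le {a b c : ℝ} (h : ∀ t : ℝ, 0 < t → a - t * b ≤ c) : a ≤ c := by
  have ht : Filter.Tendsto (fun t : ℝ => a - t * b) (nhdsWithin 0 (Ioi 0)) (nhds (a - 0 * b)) :=
    ((continuous_const.sub (continuous_id.mul continuous_const)).tendsto 0).mono_left
      nhdsWithin_le_nhds
  simpa using le_of_tendsto ht (eventually_nhdsWithin_of_forall fun t ht => h t ht)

theorem exists_lagrange_multipliers {E ι : Type*} [AddCommGroup E] [Module ℝ E] [Fintype ι]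
    {D : Set E} {f : E → ℝ} {g : ι → E → ℝ} (hf : ConcaveOn ℝ D f)
    (hg : ∀ i, ConcaveOn ℝ D (g i)) {x₀ : E} (hx₀ : x₀ ∈ D) (hslater : ∀ i, 0 < g i x₀)
    {c : ℝ} (hc : ∀ x ∈ D, (∀ i, 0 ≤ g i x) → f x ≤ c) :
    ∃ l : ι → ℝ, (∀ i, 0 ≤ l i) ∧ ∀ x ∈ D, f x + ∑ i, l i * g i x ≤ c := by
  classical
  -- Strict inequalities make `A` open without any topology on `E`; a functional separating `(0, c)`
  -- from `A` has the multipliers as coefficients.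
  set A : Set ((ι → ℝ) × ℝ) := {q | ∃ x ∈ D, (∀ i, q.1 i < g i x) ∧ q.2 < f x} with hA
  have hconv : Convex ℝ A := by
    rintro ⟨s, a⟩ ⟨x, hx, hs, ha⟩ ⟨t, b⟩ ⟨y, hy, ht, hb⟩ p q hp hq hpq
    have key : ∀ {a b a' b' : ℝ}, a < a' → b < b' → p * a + q * b < p * a' + q * b' := by
      intro a b a' b' h1 h2
      rcases hp.eq_or_lt with rfl | hp
      · obtain rfl : q = 1 := by linarith
        linarith
      · nlinarith [mul_pos hp (sub_pos.2 h1), mul_nonneg hq (sub_pos.2 h2).le]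
    refine ⟨p • x + q • y, hf.1 hx hy hp hq hpq, fun i => ?_, ?_⟩
    · exact (key (hs i) (ht i)).trans_le ((hg i).2 hx hy hp hq hpq)
    · exact (key ha hb).trans_le (hf.2 hx hy hp hq hpq)
  have hopen : IsOpen A := by
    have : A = ⋃ x ∈ D, (⋂ i, {q : (ι → ℝ) × ℝ | q.1 i < g i x}) ∩ {q | q.2 < f x} := by
      ext q
      simp only [hA, mem_ofPred_eq, mem_iUnion, mem_inter_iff, mem_iInter, exists_prop]
    rw [this]
    refine isOpen_biUnion fun x _ => IsOpen.inter (isOpen_iInter_of_finite fun i => ?_) ?_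
    · exact isOpen_lt (by fun_prop) continuous_const
    · exact isOpen_lt (by fun_prop) continuous_const
  have hnot : ((0 : ι → ℝ), c) ∉ A := by
    rintro ⟨x, hx, h1, h2⟩
    exact (hc x hx fun i => (h1 i).le).not_gt h2
  obtain ⟨F, hF⟩ := geometric_hahn_banach_open_point hconv hopen hnot
  set l : ι → ℝ := fun i => F (Pi.single i 1, 0) with hl
  set μ : ℝ := F (0, 1) with hμ
  have hFeq : ∀ (s : ι → ℝ) (a : ℝ), F (s, a) = ∑ i, l i * s i + μ * a := by
    intro s a
    have h1 : (s, a) = ∑ i, s i • ((Pi.single i 1 : ι → ℝ), (0 : ℝ)) + a • ((0 : ι → ℝ), (1 : ℝ)) := by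
      ext j
      · simp [Prod.fst_sum, Finset.sum_apply, Pi.single_apply]
      · simp [Prod.snd_sum]
    rw [h1, map_add, map_sum]
    simp only [map_smul, smul_eq_mul, hl, hμ, mul_comm]
  have hlt : ∀ x ∈ D, ∀ (s : ι → ℝ) (a : ℝ), (∀ i, s i < g i x) → a < f x →
      ∑ i, l i * s i + μ * a < μ * c := by
    intro x hx s a hs ha
    have := hF (s, a) ⟨x, hx, hs, ha⟩
    rw [hFeq, hFeq] at this
    simpa using this
  have hl0 : ∀ i, 0 ≤ l i := by
    intro i
    refine nonneg_of_forall_sub_mul_le (a := μ * (f x₀ - 1)) (c := μ * c) fun t ht => ?_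
    have := hlt x₀ hx₀ (-(t • Pi.single i 1)) (f x₀ - 1) (fun j => ?_) (by linarith)
    · simp [Pi.single_apply] at this
      linarith
    · refine lt_of_le_of_lt ?_ (hslater j)
      simp only [Pi.neg_apply, Pi.smul_apply, smul_eq_mul, Left.neg_nonpos_iff]
      exact mul_nonneg ht (by by_cases h : j = i <;> simp [h])
  -- The Slater point excludes a vertical hyperplane: with `μ = 0`, the choice `s = 0` would give `0
  -- < 0`.
  have hμ0 : 0 < μ := by
    have h0 : 0 ≤ μ := by
      refine nonneg_of_forall_sub_mul_le (a := μ * (f x₀ - 1)) (c := μ * c) fun t ht => ?_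
      have := hlt x₀ hx₀ 0 (f x₀ - 1 - t) (fun j => hslater j) (by linarith)
      simp at this
      linarith
    refine h0.lt_of_ne fun h => ?_
    have := hlt x₀ hx₀ 0 (f x₀ - 1) hslater (by linarith)
    simp [← h] at this
  refine ⟨fun i => l i / μ, fun i => div_nonneg (hl0 i) hμ0.le, fun x hx => ?_⟩
  have hle : ∑ i, l i * g i x + μ * f x ≤ μ * c := by
    refine le_of_forall_pos_sub_mul_le (b := ∑ i, l i + μ) fun t ht => ?_
    have := hlt x hx (fun i => g i x - t) (f x - t) (fun i => by linarith) (by linarith)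
    simp only [mul_sub, Finset.sum_sub_distrib, ← Finset.sum_mul] at this
    linarith
  have h2 : ∑ i, l i / μ * g i x = (∑ i, l i * g i x) / μ := by
    rw [Finset.sum_div]; exact Finset.sum_congr rfl fun i _ => by ring
  rw [h2, ← le_sub_iff_add_le', div_le_iff₀ hμ0]
  linarith

/-! ### Concave valuations -/

namespace IsConcaveValuation

variable {w : ℝ → ℝ}

lemma nonneg (hw : IsConcaveValuation w) {t : ℝ} (ht : 0 ≤ t) : 0 ≤ w t := by
  simpa [hw.zero] using hw.monotone (mem_Ici.2 le_rfl) (mem_Ici.2 ht) ht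

/-- Monotonicity covers `t ≤ 1`, the chord from the origin covers `t ≥ 1`. Linear growth lets a
small price increase pay for a small positive multiplier in `dual_le_primal`. -/
lemma le_mul_one_add (hw : IsConcaveValuation w) {t : ℝ} (ht : 0 ≤ t) :
    w t ≤ w 1 * (1 + t) := by
  have h1 := hw.nonneg zero_le_one
  rcases le_total t 1 with h | h
  · have := hw.monotone (mem_Ici.2 ht) (mem_Ici.2 zero_le_one) h
    nlinarith
  · have ht0 : 0 < t := by linarith
    have h2 := hw.concave.2 (mem_Ici.2 ht) (mem_Ici.2 le_rfl) (inv_nonneg.2 ht)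
      (sub_nonneg.2 (inv_le_one_of_one_le₀ h)) (by ring)
    simp only [smul_eq_mul, hw.zero, mul_zero, add_zero, inv_mul_cancel₀ ht0.ne'] at h2
    rw [inv_mul_le_iff₀ ht0] at h2
    nlinarith

lemma le_tangent (hw : IsConcaveValuation w) {a t d : ℝ} (ha : 0 ≤ a) (ht : 0 ≤ t)
    (hd : HasDerivWithinAt w d (Ici 0) a) : w t ≤ w a + d * (t - a) := by
  rcases lt_trichotomy a t with h | rfl | h
  · have := hw.concave.slope_le_of_hasDerivWithinAt (mem_Ici.2 ha) (mem_Ici.2 ht) h hd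
    rw [slope_def_field, div_le_iff₀ (by linarith)] at this
    linarith
  · simp
  · have := hw.concave.le_slope_of_hasDerivWithinAt (mem_Ici.2 ht) (mem_Ici.2 ha) h hd
    rw [slope_def_field, le_div_iff₀ (by linarith)] at this
    linarith

lemma deriv_anti (hw : IsConcaveValuation w) {a b d e : ℝ} (ha : 0 ≤ a) (hab : a ≤ b)
    (hd : HasDerivWithinAt w d (Ici 0) a) (he : HasDerivWithinAt w e (Ici 0) b) : e ≤ d := by
  rcases hab.eq_or_lt with rfl | hlt
  · exact (uniqueDiffOn_Ici (0 : ℝ) a ha).eq_deriv _ he hd |>.le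
  · have h1 := hw.le_tangent ha (ha.trans hab) hd
    have h2 := hw.le_tangent (ha.trans hab) ha he
    nlinarith

end IsConcaveValuation

/-! ### Slope ratios and the spending on a single good -/

lemma hasDerivWithinAt_marginal {w : ℝ → ℝ} {t : ℝ} (h : DifferentiableWithinAt ℝ w (Ici 0) t) :
    HasDerivWithinAt w (marginal w t) (Ici 0) t :=
  h.hasDerivWithinAt

lemma hasDerivAt_marginal {w : ℝ → ℝ} {t : ℝ} (ht : 0 < t) (h : DifferentiableAt ℝ w t) :
    HasDerivAt w (marginal w t) t := by
  rw [marginal, derivWithin_of_mem_nhds (Ici_mem_nhds ht)]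
  exact h.hasDerivAt

/-- First-order condition for a positive amount that maximizes `a * w t - q * t`. -/
lemma price_eq_of_isMaxOn {w : ℝ → ℝ} {a q s d : ℝ} (hs : 0 < s)
    (hmax : ∀ t, 0 ≤ t → a * w t - q * t ≤ a * w s - q * s) (hd : HasDerivAt w d s) :
    q = a * d := by
  have h1 : IsLocalMax (fun t => a * w t - q * t) s :=
    Filter.mem_of_superset (Ici_mem_nhds hs) fun t ht => hmax t ht
  have h2 := h1.hasDerivAt_eq_zero ((hd.const_mul a).sub ((hasDerivAt_id s).const_mul q))
  linarith

variable {w : ℝ → ℝ}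

lemma one_le_slopeRatio (hw : IsConcaveValuation w) (hr : HasSlopeRatio w) : 1 ≤ slopeRatio w := by
  unfold slopeRatio
  split_ifs with h
  · exact le_rfl
  · rw [one_le_div (hr.pos h)]
    exact hw.deriv_anti le_rfl zero_le_one (hasDerivWithinAt_marginal hr.diff_zero)
      (hasDerivAt_marginal one_pos hr.diff_one).hasDerivWithinAt

lemma marginal_zero_eq (hr : HasSlopeRatio w) (h : marginal w 0 ≠ 0) :
    marginal w 0 = slopeRatio w * marginal w 1 := by
  rw [slopeRatio, if_neg h, div_mul_cancel₀ _ (hr.pos h).ne']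

lemma eq_zero_of_marginal_zero (hw : IsConcaveValuation w) (hr : HasSlopeRatio w)
    (h : marginal w 0 = 0) {t : ℝ} (ht : 0 ≤ t) : w t = 0 := by
  have := hw.le_tangent le_rfl ht (hasDerivWithinAt_marginal hr.diff_zero)
  rw [hw.zero, h] at this
  linarith [hw.nonneg ht]

/-- Spending on a good is at least the scaled value divided by the slope ratio. -/
lemma value_le_slopeRatio_mul (hw : IsConcaveValuation w) (hr : HasSlopeRatio w) {a q s : ℝ}
    (ha : 0 ≤ a) (hq : 0 ≤ q) (hs : 0 ≤ s) (hs1 : s ≤ 1)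
    (hmax : ∀ t, 0 ≤ t → a * w t - q * t ≤ a * w s - q * s) :
    a * w s ≤ slopeRatio w * (q * s) := by
  have hr1 := one_le_slopeRatio hw hr
  by_cases h0 : marginal w 0 = 0
  · rw [eq_zero_of_marginal_zero hw hr h0 hs, mul_zero]; positivity
  have hd := hasDerivAt_marginal one_pos hr.diff_one
  -- `w` need not be differentiable at `s`, so for `s < 1` the tangent at 1 is compared with the
  -- maximality of `s` against `t = 1`. At `s = 1` this is vacuous and the first-order condition
  -- takes over.
  have hprice : a * marginal w 1 ≤ q := by
    rcases hs1.eq_or_lt with rfl | hlt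
    · exact (price_eq_of_isMaxOn one_pos hmax hd).ge
    · have h1 := hw.le_tangent zero_le_one hs hd.hasDerivWithinAt
      have h2 := hmax 1 zero_le_one
      nlinarith
  have h1 := hw.le_tangent le_rfl hs (hasDerivWithinAt_marginal hr.diff_zero)
  rw [hw.zero, marginal_zero_eq hr h0] at h1
  calc a * w s ≤ a * (slopeRatio w * marginal w 1 * s) := by gcongr; linarith
    _ = slopeRatio w * (a * marginal w 1 * s) := by ring
    _ ≤ slopeRatio w * (q * s) := by gcongr

/-- If `t * w' t` is non-decreasing, the factor `slopeRatio` improves to its logarithm plus one. -/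
lemma value_le_log_slopeRatio_mul (hw : IsConcaveValuation w) (hr : HasSlopeRatio w)
    (hdiff : DifferentiableOn ℝ w (Icc 0 1))
    (hmono : MonotoneOn (fun t => t * marginal w t) (Icc 0 1)) {a q s : ℝ}
    (ha : 0 ≤ a) (hq : 0 ≤ q) (hs : 0 ≤ s) (hs1 : s ≤ 1)
    (hmax : ∀ t, 0 ≤ t → a * w t - q * t ≤ a * w s - q * s) :
    a * w s ≤ (1 + Real.log (slopeRatio w)) * (q * s) := by
  have hr1 := one_le_slopeRatio hw hr
  have hlog := Real.log_nonneg hr1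
  by_cases h0 : marginal w 0 = 0
  · rw [eq_zero_of_marginal_zero hw hr h0 hs, mul_zero]; positivity
  rcases hs.eq_or_lt with rfl | hs0
  · simp [hw.zero]
  have hd : ∀ t, 0 < t → t ≤ 1 → HasDerivAt w (marginal w t) t := by
    intro t ht ht1
    refine hasDerivAt_marginal ht ?_
    rcases ht1.eq_or_lt with rfl | hlt
    · exact hr.diff_one
    · exact hdiff.differentiableAt (Icc_mem_nhds ht hlt)
  have hd0 := hasDerivWithinAt_marginal hr.diff_zero
  have hpos := hr.pos h0
  have hle1 : marginal w 1 ≤ marginal w s :=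
    hw.deriv_anti hs hs1 (hd s hs0 hs1).hasDerivWithinAt (hd 1 one_pos le_rfl).hasDerivWithinAt
  have hle0 : marginal w s ≤ marginal w 0 :=
    hw.deriv_anti le_rfl hs hd0 (hd s hs0 hs1).hasDerivWithinAt
  have hps : 0 < marginal w s := hpos.trans_le hle1
  have hp0 : 0 < marginal w 0 := hps.trans_le hle0
  -- The tangent line at 0 reaches height `k` at `b`. It bounds `w` up to `b`; from `b` to `s` the
  -- bound `w' t ≤ k / t` adds at most `k * log (s / b)`, and `s / b = w' 0 / w' s` is at most the
  -- slope ratio.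
  set k : ℝ := s * marginal w s with hk
  have hk0 : 0 < k := mul_pos hs0 hps
  set b : ℝ := k / marginal w 0 with hb
  have hb0 : 0 < b := div_pos hk0 hp0
  have hbs : b ≤ s := by
    rw [hb, div_le_iff₀ hp0]
    exact mul_le_mul_of_nonneg_left hle0 hs
  have hwb : w b ≤ k := by
    have := hw.le_tangent le_rfl hb0.le hd0
    rw [hw.zero, hb, sub_zero, mul_div_cancel₀ _ hp0.ne'] at this
    linarith
  have hder : ∀ t, b ≤ t → t ≤ s →
      HasDerivAt (fun t => w t - k * Real.log t) (marginal w t - k * t⁻¹) t := fun t h1 h2 =>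
    (hd t (hb0.trans_le h1) (h2.trans hs1)).sub
      ((Real.hasDerivAt_log (hb0.trans_le h1).ne').const_mul k)
  -- Monotonicity of this difference replaces integrating `w' t ≤ k / t`.
  have hanti : AntitoneOn (fun t => w t - k * Real.log t) (Icc b s) := by
    refine antitoneOn_of_deriv_nonpos (convex_Icc b s)
      (fun t ht => (hder t ht.1 ht.2).continuousAt.continuousWithinAt)
      (fun t ht => ?_) fun t ht => ?_
    · rw [interior_Icc] at ht
      exact (hder t ht.1.le ht.2.le).differentiableAt.differentiableWithinAt
    · rw [interior_Icc] at ht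
      rw [(hder t ht.1.le ht.2.le).deriv]
      have ht0 : 0 < t := hb0.trans ht.1
      have := hmono ⟨ht0.le, ht.2.le.trans hs1⟩ ⟨hs, hs1⟩ ht.2.le
      rw [sub_nonpos, ← div_eq_mul_inv, le_div_iff₀ ht0]
      simpa [mul_comm] using this
  have h1 : w s - k * Real.log s ≤ w b - k * Real.log b :=
    hanti ⟨le_rfl, hbs⟩ ⟨hbs, le_rfl⟩ hbs
  have h2 : Real.log s - Real.log b ≤ Real.log (slopeRatio w) := by
    rw [← Real.log_div hs0.ne' hb0.ne']
    refine Real.log_le_log (div_pos hs0 hb0) ?_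
    have : s / b = marginal w 0 / marginal w s := by
      rw [hb, hk]; field_simp
    rw [this, slopeRatio, if_neg h0]
    gcongr
  have h3 : w s ≤ (1 + Real.log (slopeRatio w)) * k := by nlinarith
  have hprice := price_eq_of_isMaxOn hs0 hmax (hd s hs0 hs1)
  calc a * w s ≤ a * ((1 + Real.log (slopeRatio w)) * k) := by gcongr
    _ = (1 + Real.log (slopeRatio w)) * (q * s) := by rw [hprice, hk]; ring

end EisenbergGale

namespace EisenbergGale

open Set

variable {n m : ℕ} {B : Fin n → ℝ} {v : Fin n → Fin m → ℝ → ℝ}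

/-! ### Strong duality -/

/-- The implicit constraints of the primal program: those that the Lagrangian does not relax. -/
def primalDomain (m : ℕ) (B : Fin n → ℝ) :
    Set ((Fin n → ℝ) × (Fin n → ℝ) × (Fin n → Fin m → ℝ)) :=
  {q | ((∀ i, 0 ≤ q.1 i) ∧ ∀ i, 0 < B i → 0 < q.1 i) ∧ (∀ i, 0 ≤ q.2.1 i) ∧ ∀ i j, 0 ≤ q.2.2 i j}

lemma convex_primalDomain (m : ℕ) (B : Fin n → ℝ) : Convex ℝ (primalDomain m B) := by
  rintro ⟨u, d, x⟩ ⟨⟨h1, h2⟩, h3, h4⟩ ⟨u', d', x'⟩ ⟨⟨h1', h2'⟩, h3', h4'⟩ a b ha hb hab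
  refine ⟨⟨fun i => ?_, fun i hi => ?_⟩, fun i => ?_, fun i j => ?_⟩
  · exact add_nonneg (mul_nonneg ha (h1 i)) (mul_nonneg hb (h1' i))
  · exact (convex_Ioi (0 : ℝ)) (h2 i hi) (h2' i hi) ha hb hab
  · exact add_nonneg (mul_nonneg ha (h3 i)) (mul_nonneg hb (h3' i))
  · exact add_nonneg (mul_nonneg ha (h4 i j)) (mul_nonneg hb (h4' i j))

lemma concaveOn_finset_sum {E ι : Type*} [AddCommGroup E] [Module ℝ E] {D : Set E}
    (hD : Convex ℝ D) (t : Finset ι) {f : ι → E → ℝ} (hf : ∀ i, ConcaveOn ℝ D (f i)) :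
    ConcaveOn ℝ D fun q => ∑ i ∈ t, f i q := by
  refine ⟨hD, fun x hx y hy a b ha hb hab => ?_⟩
  simp only [Finset.smul_sum, ← Finset.sum_add_distrib]
  exact Finset.sum_le_sum fun i _ => (hf i).2 hx hy ha hb hab

lemma concaveOn_primalObjective (hB : ∀ i, 0 ≤ B i) :
    ConcaveOn ℝ (primalDomain m B) fun q => primalObjective B q.1 q.2.1 := by
  refine concaveOn_finset_sum (convex_primalDomain m B) _ fun i => ⟨convex_primalDomain m B, ?_⟩
  intro q hq q' hq' a b ha hb hab
  have h1 : B i * (a * Real.log (q.1 i) + b * Real.log (q'.1 i)) ≤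
      B i * Real.log (a * q.1 i + b * q'.1 i) := by
    -- Without budget `u i` may be 0, where `Real.log` takes a default value, but the coefficient
    -- removes the term.
    rcases (hB i).eq_or_lt with h | h
    · simp [← h]
    · exact mul_le_mul_of_nonneg_left
        (strictConcaveOn_log_Ioi.concaveOn.2 (hq.1.2 i h) (hq'.1.2 i h) ha hb hab) (hB i)
  simp only [smul_eq_mul, Prod.fst_add, Prod.snd_add, Prod.smul_fst, Prod.smul_snd, Pi.add_apply,
    Pi.smul_apply]
  linarith

lemma concaveOn_utilitySlack (hv : ∀ i j, IsConcaveValuation (v i j)) (i : Fin n) :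
    ConcaveOn ℝ (primalDomain m B) fun q => ∑ j, v i j (q.2.2 i j) + q.2.1 i - q.1 i := by
  refine ⟨convex_primalDomain m B, fun q hq q' hq' a b ha hb hab => ?_⟩
  have h : a * ∑ j, v i j (q.2.2 i j) + b * ∑ j, v i j (q'.2.2 i j) ≤
      ∑ j, v i j (a * q.2.2 i j + b * q'.2.2 i j) := by
    rw [Finset.mul_sum, Finset.mul_sum, ← Finset.sum_add_distrib]
    exact Finset.sum_le_sum fun j _ =>
      (hv i j).concave.2 (mem_Ici.2 (hq.2.2 i j)) (mem_Ici.2 (hq'.2.2 i j)) ha hb hab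
  simp only [smul_eq_mul, Prod.fst_add, Prod.snd_add, Prod.smul_fst, Prod.smul_snd, Pi.add_apply,
    Pi.smul_apply]
  linarith

lemma concaveOn_supplySlack (j : Fin m) :
    ConcaveOn ℝ (primalDomain m B) fun q => 1 - ∑ i, q.2.2 i j := by
  refine ⟨convex_primalDomain m B, fun q hq q' hq' a b ha hb hab => ?_⟩
  simp only [smul_eq_mul, Prod.snd_add, Prod.smul_snd, Pi.add_apply, Pi.smul_apply,
    Finset.sum_add_distrib, ← Finset.mul_sum]
  nlinarith

lemma exists_multipliers (hB : ∀ i, 0 ≤ B i) (hv : ∀ i j, IsConcaveValuation (v i j))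
    {u δ : Fin n → ℝ} {x : Fin n → Fin m → ℝ} (hopt : IsPrimalOptimal B v u δ x) :
    ∃ (a : Fin n → ℝ) (q : Fin m → ℝ), (∀ i, 0 ≤ a i) ∧ (∀ j, 0 ≤ q j) ∧
      ∀ (u' δ' : Fin n → ℝ) (x' : Fin n → Fin m → ℝ), (u', δ', x') ∈ primalDomain m B →
        primalObjective B u' δ' + (∑ i, a i * (∑ j, v i j (x' i j) + δ' i - u' i)
          + ∑ j, q j * (1 - ∑ i, x' i j)) ≤ primalObjective B u δ := by
  obtain ⟨l, hl, h⟩ := exists_lagrange_multipliers (ι := Fin n ⊕ Fin m)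
    (concaveOn_primalObjective (m := m) hB)
    (g := Sum.elim (fun i q => ∑ j, v i j (q.2.2 i j) + q.2.1 i - q.1 i)
      fun j q => 1 - ∑ i, q.2.2 i j)
    -- With nothing allocated, `δ = 2` and `u = 1` leave slack 1 in every constraint.
    (x₀ := (fun _ => 1, fun _ => 2, fun _ _ => 0)) (c := primalObjective B u δ)
    (by
      rintro (i | j)
      · exact concaveOn_utilitySlack hv i
      · exact concaveOn_supplySlack j)
    ⟨⟨fun _ => zero_le_one, fun _ _ => one_pos⟩, fun _ => zero_le_two, fun _ _ => le_rfl⟩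
    (by
      rintro (i | j)
      · norm_num [(hv i _).zero]
      · simp)
    (by
      rintro ⟨u', δ', x'⟩ hq hg
      refine hopt.2 u' δ' x' ⟨fun i => ?_, fun j => ?_, hq.1.1, hq.1.2, hq.2.1, hq.2.2⟩
      · simpa using hg (Sum.inl i)
      · simpa using hg (Sum.inr j))
  refine ⟨fun i => l (Sum.inl i), fun j => l (Sum.inr j), fun i => hl _, fun j => hl _,
    fun u' δ' x' hq => ?_⟩
  simpa [Fintype.sum_sum_type] using h _ hq

/-- A bound on all values of a separable sum bounds the sum of the suprema. -/
lemma sum_iSup_le {ι κ : Type*} [Fintype ι] {h : ι → κ → ℝ} [Nonempty κ] {c : ℝ}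
    (hc : ∀ t : ι → κ, ∑ i, h i (t i) ≤ c) :
    (∀ i, BddAbove (range (h i))) ∧ ∑ i, ⨆ t, h i t ≤ c := by
  classical
  obtain ⟨t₀⟩ := ‹Nonempty κ›
  have hbdd : ∀ i, BddAbove (range (h i)) := by
    intro i
    refine ⟨c - ∑ k ∈ Finset.univ.erase i, h k t₀, ?_⟩
    rintro _ ⟨t, rfl⟩
    have h1 := hc (Function.update (fun _ => t₀) i t)
    rw [← Finset.add_sum_erase _ _ (Finset.mem_univ i), Function.update_self] at h1
    rw [Finset.sum_congr rfl fun k hk => by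
      rw [Function.update_of_ne (Finset.ne_of_mem_erase hk)]] at h1
    linarith
  refine ⟨hbdd, le_of_forall_pos_sub_mul_le (b := Fintype.card ι) fun ε hε => ?_⟩
  have : Nonempty κ := ⟨t₀⟩
  choose t ht using fun i => exists_lt_of_lt_ciSup (sub_lt_self (⨆ t, h i t) hε)
  have h2 : ∑ i, ((⨆ t, h i t) - ε) ≤ ∑ i, h i (t i) := Finset.sum_le_sum fun i _ => (ht i).le
  rw [Finset.sum_sub_distrib, Finset.sum_const, Finset.card_univ, nsmul_eq_mul, mul_comm] at h2
  exact h2.trans (hc t)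

/-- If the Lagrangian bound holds for all allocations, the dual solution is feasible and its value
obeys the same bound. -/
lemma dualObjective_le_of_forall {a : Fin n → ℝ} {q : Fin m → ℝ} {c : ℝ} (ha : ∀ i, 0 < a i)
    (ha1 : ∀ i, a i ≤ 1) (hq : ∀ j, 0 ≤ q j)
    (h : ∀ x : Fin n → Fin m → ℝ, (∀ i j, 0 ≤ x i j) →
      ∑ i, (B i * Real.log (B i / a i) - B i) + ∑ j, q j
        + ∑ i, ∑ j, (a i * v i j (x i j) - q j * x i j) ≤ c) :
    DualFeasible v a q ∧ dualObjective B v a q ≤ c := by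
  have h1 := sum_iSup_le (ι := Fin n × Fin m) (κ := Ici (0 : ℝ))
    (h := fun ij t => a ij.1 * v ij.1 ij.2 t - q ij.2 * t)
    (c := c - (∑ i, (B i * Real.log (B i / a i) - B i) + ∑ j, q j)) fun t => by
      rw [Fintype.sum_prod_type]
      linarith [h (fun i j => t (i, j)) fun i j => (t (i, j)).2]
  rw [Fintype.sum_prod_type] at h1
  refine ⟨⟨ha, ha1, hq, fun i j => h1.1 (i, j)⟩, ?_⟩
  rw [dualObjective]
  linarith [h1.2]

/-- Strong duality, in the form that the values of the optimal solutions agree. -/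
theorem dual_le_primal (hB : ∀ i, 0 ≤ B i) (hv : ∀ i j, IsConcaveValuation (v i j))
    {u δ α : Fin n → ℝ} {x : Fin n → Fin m → ℝ} {p : Fin m → ℝ}
    (hprimal : IsPrimalOptimal B v u δ x) (hdual : IsDualOptimal B v α p) :
    dualObjective B v α p ≤ primalObjective B u δ := by
  classical
  obtain ⟨a, q, ha, hq, h⟩ := exists_multipliers hB hv hprimal
  -- `δ i` enters the Lagrangian with coefficient `a i - 1`; let it tend to infinity.
  have ha1 : ∀ i, a i ≤ 1 := by
    intro i
    rw [← sub_nonneg]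
    refine nonneg_of_forall_sub_mul_le (a := ∑ k, a k * (0 - 1) + ∑ j, q j)
      (c := primalObjective B u δ) fun t ht => ?_
    have := h (fun _ => 1) (t • Pi.single i 1) 0
      ⟨⟨fun _ => zero_le_one, fun _ _ => one_pos⟩, fun k => ?_, fun _ _ => le_rfl⟩
    · simp [primalObjective, (hv _ _).zero, mul_sub, Pi.single_apply] at this ⊢
      linarith
    · exact mul_nonneg ht (by by_cases hk : k = i <;> simp [hk])
  -- If `a i = 0`, then `u i = exp t` costs nothing and gains `t * B i`, which is unbounded.
  have ha0 : ∀ i, 0 < B i → 0 < a i := by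
    intro i hi
    refine (ha i).lt_of_ne fun hai => ?_
    have hb : 0 ≤ -B i := by
      refine nonneg_of_forall_sub_mul_le (a := ∑ k, a k * (0 - 1) + ∑ j, q j)
        (c := primalObjective B u δ) fun t ht => ?_
      have := h (Function.update (fun _ => 1) i (Real.exp t)) 0 0
        ⟨?_, fun k => le_rfl, fun _ _ => le_rfl⟩
      · have e1 : primalObjective B (Function.update (fun _ => 1) i (Real.exp t)) 0 = t * B i := by
          rw [primalObjective, Finset.sum_eq_single i]
          · simp [mul_comm]
          · intro k _ hk; simp [Function.update_of_ne hk]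
          · simp
        have e2 : ∑ k, a k * (∑ j, v k j ((0 : Fin n → Fin m → ℝ) k j) + (0 : Fin n → ℝ) k
            - Function.update (fun _ => (1 : ℝ)) i (Real.exp t) k) = ∑ k, a k * (0 - 1) := by
          refine Finset.sum_congr rfl fun k _ => ?_
          by_cases hk : k = i
          · subst hk; simp [← hai]
          · simp [(hv _ _).zero, Function.update_of_ne hk]
        rw [e1, e2] at this
        simp at this ⊢
        linarith
      · have : ∀ k, 0 < Function.update (fun _ => (1 : ℝ)) i (Real.exp t) k := by
          intro k
          by_cases hk : k = i
          · subst hk; simp [Real.exp_pos]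
          · simp [Function.update_of_ne hk]
        exact ⟨fun k => (this k).le, fun k _ => this k⟩
    linarith
  have hL : ∀ y : Fin n → Fin m → ℝ, (∀ i j, 0 ≤ y i j) →
      ∑ i, (B i * Real.log (B i / a i) - B i) + ∑ j, q j
        + ∑ i, ∑ j, (a i * v i j (y i j) - q j * y i j) ≤ primalObjective B u δ := by
    intro y hy
    -- `B i / a i` maximizes `B i * ln u - a i * u`. For `B i = 0` it is 0, even if `a i = 0`.
    have := h (fun i => B i / a i) 0 y
      ⟨⟨fun i => div_nonneg (hB i) (ha i), fun i hi => div_pos hi (ha0 i hi)⟩, fun _ => le_rfl, hy⟩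
    refine le_trans (le_of_eq ?_) this
    have e1 : ∀ i, a i * (B i / a i) = B i := by
      intro i
      rcases (hB i).eq_or_lt with hi | hi
      · simp [← hi]
      · exact mul_div_cancel₀ _ (ha0 i hi).ne'
    have e2 : ∑ j, ∑ i, q j * y i j = ∑ i, ∑ j, q j * y i j := Finset.sum_comm
    simp only [primalObjective, Pi.zero_apply, mul_sub, add_zero, sub_zero,
      mul_one, e1, Finset.sum_sub_distrib, Finset.mul_sum, e2]
    ring
  set K : ℝ := ∑ i, ∑ j, v i j 1 with hK
  have hK0 : 0 ≤ K := Finset.sum_nonneg fun i _ => Finset.sum_nonneg fun j _ =>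
    (hv i j).nonneg zero_le_one
  have hvK : ∀ i j, v i j 1 ≤ K := fun i j =>
    (Finset.single_le_sum (f := fun j => v i j 1) (fun j _ => (hv i j).nonneg zero_le_one)
      (Finset.mem_univ j)).trans
    (Finset.single_le_sum (f := fun i => ∑ j, v i j 1)
      (fun i _ => Finset.sum_nonneg fun j _ => (hv i j).nonneg zero_le_one) (Finset.mem_univ i))
  refine le_of_forall_pos_sub_mul_le (b := m + n * m) fun η hη => ?_
  -- Buyers without budget may have multiplier zero, which the dual program excludes.
  set ε : ℝ := min 1 (η / (K + 1)) with hε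
  have hε0 : 0 < ε := lt_min one_pos (by positivity)
  have hεK : ε * K ≤ η := by
    have : ε * (K + 1) ≤ η := (le_div_iff₀ (by positivity)).1 (min_le_right _ _)
    nlinarith
  -- A new multiplier `ε` contributes at most `η * (1 + t)` per good. Raising prices by `η` absorbs
  -- `η * t`; the remaining `η` per pair and the price increase itself cost `η * (n * m + m)`.
  have key := dualObjective_le_of_forall (B := B) (v := v)
    (a := fun i => if a i = 0 then ε else a i)
    (q := fun j => q j + η) (c := primalObjective B u δ + η * (m + n * m))
    (fun i => by
      split_ifs with hi
      · exact hε0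
      · exact (ha i).lt_of_ne' hi)
    (fun i => by
      split_ifs with hi
      · exact min_le_left _ _
      · exact ha1 i)
    (fun j => add_nonneg (hq j) hη.le)
    (fun y hy => by
      have e1 : ∀ i, B i * Real.log (B i / if a i = 0 then ε else a i) - B i =
          B i * Real.log (B i / a i) - B i := by
        intro i
        split_ifs with hi
        · have : B i = 0 := by
            by_contra hne
            exact (ha0 i ((hB i).lt_of_ne' hne)).ne' hi
          simp [this]
        · rfl
      have e2 : ∑ i, ∑ j, ((if a i = 0 then ε else a i) * v i j (y i j) - (q j + η) * y i j) ≤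
          ∑ i, ∑ j, ((a i * v i j (y i j) - q j * y i j) + η) := by
        refine Finset.sum_le_sum fun i _ => Finset.sum_le_sum fun j _ => ?_
        have hy0 := hy i j
        have := mul_nonneg hη.le hy0
        split_ifs with hi
        · rw [hi]
          have h1 : ε * v i j (y i j) ≤ η * (1 + y i j) :=
            calc ε * v i j (y i j) ≤ ε * (K * (1 + y i j)) := by
                  gcongr
                  exact ((hv i j).le_mul_one_add hy0).trans (by gcongr; exact hvK i j)
              _ = ε * K * (1 + y i j) := by ring
              _ ≤ η * (1 + y i j) := by gcongr
          linarith
        · linarith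
      have e3 := hL y hy
      simp only [e1]
      simp only [Finset.sum_add_distrib, Finset.sum_const, Finset.card_univ, Fintype.card_fin,
        nsmul_eq_mul] at e2 e3 ⊢
      linarith)
  have := hdual.2 _ _ key.1
  linarith [key.2]

/-! ### Complementary slackness -/

/-- This is Fenchel–Young for `b * ln`: with `y = a * w / b` the gap is `b * (y - 1 - ln y)`, zero
only at `y = 1`. For `b = 0` it is `a * w`. -/
lemma log_gap_nonneg {b a w : ℝ} (hb : 0 ≤ b) (ha : 0 < a) (hw : 0 ≤ w) (hbw : 0 < b → 0 < w) :
    0 ≤ b * Real.log (b / a) - b - b * Real.log w + a * w ∧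
      (b * Real.log (b / a) - b - b * Real.log w + a * w = 0 → a * w = b) := by
  rcases hb.eq_or_lt with rfl | hb
  · simpa using mul_nonneg ha.le hw
  have hw := hbw hb
  have e : b * Real.log (b / a) - b - b * Real.log w + a * w =
      b * (a * w / b - 1 - Real.log (a * w / b)) := by
    rw [Real.log_div hb.ne' ha.ne', Real.log_div (by positivity) hb.ne',
      Real.log_mul ha.ne' hw.ne']
    field_simp
    ring
  have hy : 0 < a * w / b := by positivity
  rw [e]
  refine ⟨mul_nonneg hb.le (by linarith [Real.log_le_sub_one_of_pos hy]), fun h => ?_⟩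
  by_contra hne
  have h1 := Real.log_lt_sub_one_of_pos hy fun h1 => hne ((div_eq_one_iff_eq hb.ne').1 h1)
  have := mul_pos hb (by linarith : 0 < a * w / b - 1 - Real.log (a * w / b))
  linarith

/-- The optimality conditions that link a primal and a dual solution of equal value. -/
structure ComplementarySlackness (B : Fin n → ℝ) (v : Fin n → Fin m → ℝ → ℝ)
    (u δ : Fin n → ℝ) (x : Fin n → Fin m → ℝ) (α : Fin n → ℝ) (p : Fin m → ℝ) : Prop where
  scaled_utility : ∀ i, α i * u i = B i
  delta : ∀ i, δ i * (1 - α i) = 0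
  utility : ∀ i, u i = ∑ j, v i j (x i j) + δ i
  supply : ∀ j, p j * (1 - ∑ i, x i j) = 0
  isMax : ∀ i j t, 0 ≤ t → α i * v i j t - p j * t ≤ α i * v i j (x i j) - p j * x i j

theorem complementarySlackness (hB : ∀ i, 0 ≤ B i) (hv : ∀ i j, IsConcaveValuation (v i j))
    {u δ α : Fin n → ℝ} {x : Fin n → Fin m → ℝ} {p : Fin m → ℝ}
    (hprimal : IsPrimalOptimal B v u δ x) (hdual : IsDualOptimal B v α p) :
    ComplementarySlackness B v u δ x α p := by
  have hgap := dual_le_primal hB hv hprimal hdual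
  obtain ⟨hP, -⟩ := hprimal
  obtain ⟨hD, -⟩ := hdual
  set S : Fin n → Fin m → ℝ := fun i j => ⨆ t : Ici (0 : ℝ), (α i * v i j t - p j * t) with hS
  have hle : ∀ i j t, 0 ≤ t → α i * v i j t - p j * t ≤ S i j := fun i j t ht =>
    le_ciSup (hD.bounded i j) (⟨t, ht⟩ : Ici (0 : ℝ))
  set T₁ : Fin n → ℝ :=
    fun i => B i * Real.log (B i / α i) - B i - B i * Real.log (u i) + α i * u i with hT₁
  set T₂ : Fin n → ℝ := fun i => δ i * (1 - α i) with hT₂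
  set T₃ : Fin n → ℝ := fun i => α i * (∑ j, v i j (x i j) + δ i - u i) with hT₃
  set T₄ : Fin m → ℝ := fun j => p j * (1 - ∑ i, x i j) with hT₄
  set T₅ : Fin n → Fin m → ℝ := fun i j => S i j - (α i * v i j (x i j) - p j * x i j) with hT₅
  have h₁ : ∀ i, 0 ≤ T₁ i := fun i =>
    (log_gap_nonneg (hB i) (hD.alpha_pos i) (hP.u_nonneg i) (hP.u_pos i)).1
  have h₂ : ∀ i, 0 ≤ T₂ i := fun i =>
    mul_nonneg (hP.delta_nonneg i) (sub_nonneg.2 (hD.alpha_le_one i))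
  have h₃ : ∀ i, 0 ≤ T₃ i := fun i =>
    mul_nonneg (hD.alpha_pos i).le (sub_nonneg.2 (hP.utility i))
  have h₄ : ∀ j, 0 ≤ T₄ j := fun j =>
    mul_nonneg (hD.price_nonneg j) (sub_nonneg.2 (hP.supply j))
  have h₅ : ∀ i j, 0 ≤ T₅ i j := fun i j => sub_nonneg.2 (hle i j _ (hP.x_nonneg i j))
  -- The gap splits into the Fenchel–Young gaps, the slacks of `α ≤ 1`, utility and supply weighted
  -- by their multipliers, and the shortfalls from the suprema.
  have hsum : ∑ i, T₁ i + ∑ i, T₂ i + ∑ i, T₃ i + ∑ j, T₄ j + ∑ i, ∑ j, T₅ i j =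
      dualObjective B v α p - primalObjective B u δ := by
    have e : ∑ j, ∑ i, p j * x i j = ∑ i, ∑ j, p j * x i j := Finset.sum_comm
    simp only [hT₁, hT₂, hT₃, hT₄, hT₅, dualObjective, primalObjective, mul_sub, mul_add, mul_one,
      Finset.sum_sub_distrib, Finset.sum_add_distrib, Finset.mul_sum, e]
    simp only [hS, mul_comm]
    ring
  have s₁ := Fintype.sum_nonneg (f := T₁) h₁
  have s₂ := Fintype.sum_nonneg (f := T₂) h₂
  have s₃ := Fintype.sum_nonneg (f := T₃) h₃
  have s₄ := Fintype.sum_nonneg (f := T₄) h₄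
  have h₅' : ∀ i, 0 ≤ ∑ j, T₅ i j := fun i => Fintype.sum_nonneg (h₅ i)
  have s₅ := Fintype.sum_nonneg (f := fun i => ∑ j, T₅ i j) h₅'
  have z₁ := (Fintype.sum_eq_zero_iff_of_nonneg (f := T₁) h₁).1 (by linarith)
  have z₂ := (Fintype.sum_eq_zero_iff_of_nonneg (f := T₂) h₂).1 (by linarith)
  have z₃ := (Fintype.sum_eq_zero_iff_of_nonneg (f := T₃) h₃).1 (by linarith)
  have z₄ := (Fintype.sum_eq_zero_iff_of_nonneg (f := T₄) h₄).1 (by linarith)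
  have z₅ := (Fintype.sum_eq_zero_iff_of_nonneg (f := fun i => ∑ j, T₅ i j) h₅').1 (by linarith)
  refine ⟨fun i => ?_, fun i => congrFun z₂ i, fun i => ?_, fun j => congrFun z₄ j,
    fun i j t ht => ?_⟩
  · exact (log_gap_nonneg (hB i) (hD.alpha_pos i) (hP.u_nonneg i) (hP.u_pos i)).2 (congrFun z₁ i)
  · have := (mul_eq_zero.1 (congrFun z₃ i)).resolve_left (hD.alpha_pos i).ne'
    linarith
  · have := congrFun ((Fintype.sum_eq_zero_iff_of_nonneg (f := T₅ i) (h₅ i)).1 (congrFun z₅ i)) j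
    have h := hle i j t ht
    simp only [hT₅, Pi.zero_apply] at this
    linarith

/-! ### Consequences for buyers -/

namespace ComplementarySlackness

variable {u δ α : Fin n → ℝ} {x : Fin n → Fin m → ℝ} {p : Fin m → ℝ}

lemma spending_le (h : ComplementarySlackness B v u δ x α p)
    (hv : ∀ i j, IsConcaveValuation (v i j)) (i : Fin n) (j : Fin m) :
    p j * x i j ≤ α i * v i j (x i j) := by
  have := h.isMax i j 0 le_rfl
  rw [(hv i j).zero] at this
  linarith

lemma total_spending_le (h : ComplementarySlackness B v u δ x α p)
    (hv : ∀ i j, IsConcaveValuation (v i j)) (hα : ∀ i, 0 ≤ α i) (hδ : ∀ i, 0 ≤ δ i) (i : Fin n) :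
    ∑ j, p j * x i j ≤ B i := by
  have h1 : ∑ j, p j * x i j ≤ ∑ j, α i * v i j (x i j) :=
    Finset.sum_le_sum fun j _ => h.spending_le hv i j
  rw [← Finset.mul_sum] at h1
  have h2 := h.scaled_utility i
  rw [h.utility i] at h2
  nlinarith [mul_nonneg (hα i) (hδ i)]

/-- A buyer whose multiplier is one buys an unconstrained utility-maximizing bundle; any other buyer
spends a `1 / c` fraction of the budget if each good's scaled value is at most `c` times the
spending. -/
lemma utilityMaximizing_or (h : ComplementarySlackness B v u δ x α p)
    (hv : ∀ i j, IsConcaveValuation (v i j)) (hP : PrimalFeasible B v u δ x)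
    (hα : ∀ i, 0 ≤ α i) (hp : ∀ j, 0 ≤ p j) {c : ℝ} (hc : 0 ≤ c) {i : Fin n}
    (hval : ∀ j, α i * v i j (x i j) ≤ c * (p j * x i j)) :
    IsUtilityMaximizing (v i) p (B i) (x i) ∨ B i / c ≤ ∑ j, p j * x i j := by
  rcases mul_eq_zero.1 (h.delta i) with hδ | hδ
  · right
    refine div_le_of_le_mul₀ hc
      (Finset.sum_nonneg fun j _ => mul_nonneg (hp j) (hP.x_nonneg i j)) ?_
    rw [← h.scaled_utility i, h.utility i, hδ, add_zero, Finset.mul_sum, mul_comm, Finset.mul_sum]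
    exact Finset.sum_le_sum fun j _ => hval j
  · left
    refine ⟨⟨hP.x_nonneg i, h.total_spending_le hv hα hP.delta_nonneg i⟩, fun y hy => ?_⟩
    refine Finset.sum_le_sum (f := fun j => v i j (y j) - p j * y j) fun j _ => ?_
    have h1 := h.isMax i j (y j) (hy.1 j)
    have hα1 : α i = 1 := by linarith
    simpa only [hα1, one_mul] using h1

end ComplementarySlackness

lemma PrimalFeasible.x_le_one {u δ : Fin n → ℝ} {x : Fin n → Fin m → ℝ}
    (hP : PrimalFeasible B v u δ x) (i : Fin n) (j : Fin m) : x i j ≤ 1 :=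
  (Finset.single_le_sum (f := fun k => x k j) (fun k _ => hP.x_nonneg k j)
    (Finset.mem_univ i)).trans (hP.supply j)

lemma slopeRatio_le_maxSlopeRatio (v : Fin n → Fin m → ℝ → ℝ) (i : Fin n) (j : Fin m) :
    slopeRatio (v i j) ≤ maxSlopeRatio v :=
  le_ciSup (f := fun ij : Fin n × Fin m => slopeRatio (v ij.1 ij.2))
    (finite_range _).bddAbove (i, j)

/-- With no buyer or no good the real supremum over the empty family is 0; the factors 0 and `1 +
Real.log 0 = 1` are still nonnegative, which is all that `utilityMaximizing_or` asks of `c`. -/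
lemma maxSlopeRatio_eq_zero_or (hv : ∀ i j, IsConcaveValuation (v i j))
    (hr : ∀ i j, HasSlopeRatio (v i j)) : maxSlopeRatio v = 0 ∨ 1 ≤ maxSlopeRatio v := by
  rcases isEmpty_or_nonempty (Fin n × Fin m) with _ | ⟨⟨i, j⟩⟩
  · exact Or.inl (Real.iSup_of_isEmpty _)
  · exact Or.inr ((one_le_slopeRatio (hv i j) (hr i j)).trans (slopeRatio_le_maxSlopeRatio v i j))

end EisenbergGale

theorem theorem6p2 {n m : ℕ} (B : Fin n → ℝ) (hB : ∀ i, 0 ≤ B i)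
    (v : Fin n → Fin m → ℝ → ℝ) (hv : ∀ i j, EisenbergGale.IsConcaveValuation (v i j))
    (u δ : Fin n → ℝ) (x : Fin n → Fin m → ℝ) (α : Fin n → ℝ) (p : Fin m → ℝ)
    (hprimal : EisenbergGale.IsPrimalOptimal B v u δ x)
    (hdual : EisenbergGale.IsDualOptimal B v α p) :
    (∀ i j, p j * x i j ≤ v i j (x i j)) ∧
    (∀ i, ∑ j, p j * x i j ≤ B i) ∧
    (∀ j, 0 < p j → ∑ i, x i j = 1) ∧
    ((∀ i j, EisenbergGale.HasSlopeRatio (v i j)) →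
      ∀ i, EisenbergGale.IsUtilityMaximizing (v i) p (B i) (x i) ∨
        B i / EisenbergGale.maxSlopeRatio v ≤ ∑ j, p j * x i j) ∧
    ((∀ i j, EisenbergGale.HasSlopeRatio (v i j)) →
      (∀ i j, DifferentiableOn ℝ (v i j) (Set.Icc 0 1)) →
      (∀ i j, MonotoneOn (fun t => t * EisenbergGale.marginal (v i j) t) (Set.Icc 0 1)) →
      ∀ i, EisenbergGale.IsUtilityMaximizing (v i) p (B i) (x i) ∨
        B i / (1 + Real.log (EisenbergGale.maxSlopeRatio v)) ≤ ∑ j, p j * x i j) := by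
  have hcs := EisenbergGale.complementarySlackness hB hv hprimal hdual
  have hP := hprimal.1
  have hD := hdual.1
  have hα : ∀ i, 0 ≤ α i := fun i => (hD.alpha_pos i).le
  have hpx : ∀ i j, 0 ≤ p j * x i j := fun i j =>
    mul_nonneg (hD.price_nonneg j) (hP.x_nonneg i j)
  refine ⟨fun i j => ?_, hcs.total_spending_le hv hα hP.delta_nonneg, fun j hj => ?_,
    fun hr i => ?_, fun hr hdiff hmono i => ?_⟩
  · exact (hcs.spending_le hv i j).trans
      (mul_le_of_le_one_left ((hv i j).nonneg (hP.x_nonneg i j)) (hD.alpha_le_one i))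
  · have := (mul_eq_zero.1 (hcs.supply j)).resolve_left hj.ne'
    linarith
  · refine hcs.utilityMaximizing_or hv hP hα hD.price_nonneg ?_ fun j => ?_
    · rcases EisenbergGale.maxSlopeRatio_eq_zero_or hv hr with h | h <;> linarith
    · exact (EisenbergGale.value_le_slopeRatio_mul (hv i j) (hr i j) (hα i) (hD.price_nonneg j)
        (hP.x_nonneg i j) (hP.x_le_one i j) (hcs.isMax i j)).trans
        (mul_le_mul_of_nonneg_right (EisenbergGale.slopeRatio_le_maxSlopeRatio v i j) (hpx i j))
  · refine hcs.utilityMaximizing_or hv hP hα hD.price_nonneg ?_ fun j => ?_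
    · rcases EisenbergGale.maxSlopeRatio_eq_zero_or hv hr with h | h
      · simp [h]
      · linarith [Real.log_nonneg h]
    · have h1 := EisenbergGale.one_le_slopeRatio (hv i j) (hr i j)
      refine (EisenbergGale.value_le_log_slopeRatio_mul (hv i j) (hr i j) (hdiff i j) (hmono i j)
        (hα i) (hD.price_nonneg j) (hP.x_nonneg i j) (hP.x_le_one i j) (hcs.isMax i j)).trans
        (mul_le_mul_of_nonneg_right ?_ (hpx i j))
      have := Real.log_le_log (by linarith) (EisenbergGale.slopeRatio_le_maxSlopeRatio v i j)
      linarith
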